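/- Let $(E,\|\cdot\|_E)$ be an infinite-dimensional real Banach space with an unconditional Schauder basis $(e_n)_{n\in\mathbb N}$. Suppose that $E$ admits an equivalent norm $\|\cdot\|$ that is of class $C^1$ on $E\setminus\{0\}$ and locally depends on finitely many coordinates, that is, for every $x\in E\setminus\{0\}$ there are an open neighbourhood $V$ of $x$, finitely many continuous linear functionals $L_1,\dots,L_l\in E^*$ and a function $\gamma:\mathbb R^l\to\mathbb R$ with $\|y\|=\gamma(L_1(y),\dots,L_l(y))$ for all $y\in V$. Let $f:E\to\mathbb R^d$ be a $C^1$ map, let $\varepsilon:E\to(0,\infty)$ be continuous, and let $U\subseteq E$ be an open set that contains the critical set $C_f=\{x\in E: Df(x):E\to\mathbb R^d \text{ is not surjective}\}$. Then there exists a $C^1$ map $\varphi:E\to\mathbb R^d$ such that 1. $|f(x)-\varphi(x)|\le\varepsilon(x)$ for all $x\in E$, where $|\cdot|$ is the Euclidean norm; 2. $f(x)=\varphi(x)$ for all $x\in E\setminus U$; 3. $\|Df(x)-D\varphi(x)\|\le\varepsilon(x)$ for all $x\in E$, where $\|\cdot\|$ is the operator norm from $(E,\|\cdot\|_E)$ to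 $(\mathbb R^d,|\cdot|)$; 4. $D\varphi(x)$ is surjective for all $x\in E$. -/

import Mathlib

section

variable {E : Type*} [NormedAddCommGroup E] [NormedSpace ℝ E]

/-- `p` is a norm on `E` equivalent to the given one: `c ‖x‖ ≤ p x ≤ C ‖x‖` for some
constants `c, C > 0`. -/
def IsEquivalentNorm (p : Seminorm ℝ E) : Prop :=
  ∃ c C : ℝ, 0 < c ∧ 0 < C ∧ ∀ x : E, c * ‖x‖ ≤ p x ∧ p x ≤ C * ‖x‖

/-- The norm `p` is of class `C¹`, which for a norm means: on `E \ {0}`. -/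
def IsC1Norm (p : Seminorm ℝ E) : Prop :=
  ContDiffOn ℝ 1 p {0}ᶜ

/-- The norm `p` locally depends on finitely many coordinates: near every `x ≠ 0` it is a function
of the values of finitely many continuous linear functionals. (The origin has to be left out: near
`0` no norm on an infinite-dimensional space depends on finitely many functionals.) -/
def LocallyDependsOnFinitelyManyCoordinates (p : Seminorm ℝ E) : Prop :=
  ∀ x : E, x ≠ 0 → ∃ (l : ℕ) (V : Set E) (L : Fin l → StrongDual ℝ E) (γ : (Fin l → ℝ) → ℝ),
    IsOpen V ∧ x ∈ V ∧ ∀ y ∈ V, p y = γ (fun i => L i y)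

/-- The set of critical points of `f`: the points where the Fréchet derivative is not surjective. -/
def criticalSet {F : Type*} [NormedAddCommGroup F] [NormedSpace ℝ F] (f : E → F) : Set E :=
  {x | ¬ Function.Surjective (fderiv ℝ f x)}

end

/-! Call a map finitely determined if near each point its values depend on finitely many
functionals. By separability, countably many functionals suffice for the whole map
(`FinitelyDeterminedAt.exists_countable`), whereas a countable set does not span the
infinite-dimensional Banach space `E*`, even up to finitely many dimensions. So there is `T = (t₁,
…, t_d)` independent modulo their span. If `h` and `ψ` are finitely determined and `ψ x ≠ 0`, then
`h + ψ T` is regular at `x`: on the common kernel of the finitely many functionals relevant at `x`,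
the map `T` is still onto, while `h` and `ψ` are constant along short segments from `x` in these
directions (`surjective_fderiv_of_finitelyDetermined`).

It remains to approximate `f` in the `C¹` sense by finitely determined maps. Cutting off small tails
in the basis expansion gives finitely determined maps `Φ` near the identity; unconditionality bounds
`DΦ`, but does not make it close to the identity. With `D = Df(x)`, the corrected map `f ∘ Φ + D - D
∘ Φ` is nevertheless `C¹`-close to `f` wherever `Df` is close to `D`
(`exists_finitelyDetermined_approx`). These local approximations, plus small multiples of `T`, are
glued by a finitely determined partition of unity on `U`. Errors dominated by the squared distance
to the complement of `U` let the perturbation extend by zero. -/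

open Filter Topology Set
open scoped NNReal

/-! ### Maps that locally depend on finitely many functionals -/

section FinitelyDetermined

variable {E F G H : Type*} [NormedAddCommGroup E] [NormedSpace ℝ E]

/-- Near `x`, the values of `g` are determined by the values of finitely many functionals
taken from `S`. -/
def FinitelyDeterminedAt (S : Set (StrongDual ℝ E)) (g : E → F) (x : E) : Prop :=
  ∃ A : Finset (StrongDual ℝ E), ↑A ⊆ S ∧
    ∀ᶠ q : E × E in 𝓝 (x, x), (∀ L ∈ A, L q.1 = L q.2) → g q.1 = g q.2

namespace FinitelyDeterminedAt

variable {S S' : Set (StrongDual ℝ E)} {g : E → F} {g' : E → G} {x : E}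

theorem mono (h : FinitelyDeterminedAt S g x) (hS : S ⊆ S') : FinitelyDeterminedAt S' g x := by
  obtain ⟨A, hA, h⟩ := h
  exact ⟨A, hA.trans hS, h⟩

theorem const (c : F) : FinitelyDeterminedAt S (fun _ => c) x :=
  ⟨∅, by simp, by simp⟩

theorem map (h : FinitelyDeterminedAt S g x) (k : F → H) :
    FinitelyDeterminedAt S (fun y => k (g y)) x := by
  obtain ⟨A, hA, h⟩ := h
  refine ⟨A, hA, ?_⟩
  filter_upwards [h] with q hq hL
  rw [hq hL]

theorem map₂ (h : FinitelyDeterminedAt S g x) (h' : FinitelyDeterminedAt S g' x)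
    (k : F → G → H) : FinitelyDeterminedAt S (fun y => k (g y) (g' y)) x := by
  classical
  obtain ⟨A, hA, h⟩ := h
  obtain ⟨A', hA', h'⟩ := h'
  refine ⟨A ∪ A', by simp [hA, hA'], ?_⟩
  filter_upwards [h, h'] with q hq hq' hL
  rw [hq fun L hl => hL L (Finset.mem_union_left _ hl),
    hq' fun L hl => hL L (Finset.mem_union_right _ hl)]

theorem congr {g₁ : E → F} (h : FinitelyDeterminedAt S g x) (he : g₁ =ᶠ[𝓝 x] g) :
    FinitelyDeterminedAt S g₁ x := by
  obtain ⟨A, hA, h⟩ := h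
  refine ⟨A, hA, ?_⟩
  have h1 : ∀ᶠ q : E × E in 𝓝 (x, x), g₁ q.1 = g q.1 :=
    (continuous_fst.tendsto (x, x)).eventually he
  have h2 : ∀ᶠ q : E × E in 𝓝 (x, x), g₁ q.2 = g q.2 :=
    (continuous_snd.tendsto (x, x)).eventually he
  filter_upwards [h, h1, h2] with q hq e1 e2 hL
  rw [e1, e2, hq hL]

theorem sum [AddCommMonoid F] {ι : Type*} (s : Finset ι) {u : ι → E → F}
    (h : ∀ i ∈ s, FinitelyDeterminedAt S (u i) x) :
    FinitelyDeterminedAt S (fun y => ∑ i ∈ s, u i y) x := by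
  classical
  induction s using Finset.induction_on with
  | empty => simpa using const (0 : F)
  | insert i s hi ih =>
    simp only [Finset.sum_insert hi]
    exact (h i (Finset.mem_insert_self _ _)).map₂
      (ih fun j hj => h j (Finset.mem_insert_of_mem hj)) (· + ·)

theorem functional (L : StrongDual ℝ E) : FinitelyDeterminedAt univ (fun y => L y) x :=
  ⟨{L}, by simp, by simp⟩

theorem linear_euclidean {d : ℕ} (T : E →L[ℝ] EuclideanSpace ℝ (Fin d)) :
    FinitelyDeterminedAt univ (fun y => T y) x := by
  classical
  refine ⟨Finset.univ.image fun i => (EuclideanSpace.proj i).comp T, by simp, ?_⟩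
  filter_upwards with q hq
  ext i
  simpa using hq ((EuclideanSpace.proj i).comp T)
    (Finset.mem_image_of_mem _ (Finset.mem_univ i))

theorem comp_affine (T : E →L[ℝ] E) (a : E) (h : FinitelyDeterminedAt univ g (T x - a)) :
    FinitelyDeterminedAt univ (fun y => g (T y - a)) x := by
  classical
  obtain ⟨A, -, h⟩ := h
  refine ⟨A.image fun L => L.comp T, by simp, ?_⟩
  have ht : Tendsto (fun q : E × E => (T q.1 - a, T q.2 - a)) (𝓝 (x, x))
      (𝓝 (T x - a, T x - a)) := by
    have : Continuous fun q : E × E => (T q.1 - a, T q.2 - a) := by fun_prop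
    exact this.tendsto (x, x)
  filter_upwards [ht.eventually h] with q hq hL
  refine hq fun L hl => ?_
  have := hL (L.comp T) (Finset.mem_image_of_mem _ hl)
  simpa using this

/-- This is the form in which finite determination enters the regularity argument: the map is
constant on short segments in directions of finite codimension. -/
theorem eventually_line (h : FinitelyDeterminedAt S g x) :
    ∃ A : Finset (StrongDual ℝ E), ↑A ⊆ S ∧ ∀ v : E, (∀ L ∈ A, L v = 0) →
      ∀ᶠ t : ℝ in 𝓝 0, g (x + t • v) = g x := by
  obtain ⟨A, hA, h⟩ := h
  refine ⟨A, hA, fun v hv => ?_⟩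
  have ht : Tendsto (fun t : ℝ => (x + t • v, x)) (𝓝 0) (𝓝 (x, x)) := by
    have : Continuous fun t : ℝ => (x + t • v, x) := by fun_prop
    simpa using this.tendsto 0
  filter_upwards [ht.eventually h] with t ht
  exact ht fun L hl => by simp [hv L hl]

/-- Comparing pairs near `(x, x)`, rather than points with `x` alone, lets one finite set serve all
points near `x`. A Lindelöf subcover then needs only countably many such sets. -/
theorem exists_countable [SecondCountableTopology E]
    (h : ∀ x, FinitelyDeterminedAt univ g x) :
    ∃ S : Set (StrongDual ℝ E), S.Countable ∧ ∀ x, FinitelyDeterminedAt S g x := by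
  choose A _ hA using h
  have hV : ∀ x, ∃ V : Set E, IsOpen V ∧ x ∈ V ∧ ∀ y ∈ V, ∀ z ∈ V,
      (∀ L ∈ A x, L y = L z) → g y = g z := by
    intro x
    have := hA x
    rw [nhds_prod_eq] at this
    obtain ⟨V, hV, h⟩ := (eventually_prod_self_iff
      (r := fun y z => (∀ L ∈ A x, L y = L z) → g y = g z)).1 this
    obtain ⟨W, hWV, hW, hxW⟩ := mem_nhds_iff.1 hV
    exact ⟨W, hW, hxW, fun y hy z hz => h y (hWV hy) z (hWV hz)⟩
  choose V hVo hxV hV using hV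
  obtain ⟨s, hs, hsU⟩ := TopologicalSpace.countable_cover_nhds
    fun x => (hVo x).mem_nhds (hxV x)
  refine ⟨⋃ x ∈ s, (A x : Set (StrongDual ℝ E)),
    hs.biUnion fun x _ => (A x).countable_toSet, fun y => ?_⟩
  have hy : y ∈ ⋃ x ∈ s, V x := by rw [hsU]; trivial
  simp only [mem_iUnion] at hy
  obtain ⟨x, hx, hyx⟩ := hy
  refine ⟨A x, subset_biUnion_of_mem (u := fun x => (A x : Set (StrongDual ℝ E))) hx, ?_⟩
  have hn := prod_mem_nhds ((hVo x).mem_nhds hyx) ((hVo x).mem_nhds hyx)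
  filter_upwards [hn] with q hq hL
  exact hV x _ hq.1 _ hq.2 hL

end FinitelyDeterminedAt

theorem LocallyDependsOnFinitelyManyCoordinates.finitelyDeterminedAt {p : Seminorm ℝ E}
    (h : LocallyDependsOnFinitelyManyCoordinates p) {x : E} (hx : x ≠ 0) :
    FinitelyDeterminedAt univ p x := by
  classical
  obtain ⟨l, V, L, γ, hV, hxV, hγ⟩ := h x hx
  refine ⟨Finset.univ.image L, by simp, ?_⟩
  filter_upwards [prod_mem_nhds (hV.mem_nhds hxV) (hV.mem_nhds hxV)] with q hq hL
  rw [hγ _ hq.1, hγ _ hq.2]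
  congr 1
  ext i
  exact hL _ (Finset.mem_image_of_mem _ (Finset.mem_univ i))

end FinitelyDetermined

/-! ### Smooth steps and their composition with the norm -/

section Step

/-- A smooth function that is `0` on `(-∞, 1]` and `1` on `[2, ∞)`. -/
noncomputable def smoothStep (t : ℝ) : ℝ := Real.smoothTransition (t - 1)

theorem smoothStep_nonneg (t : ℝ) : 0 ≤ smoothStep t := Real.smoothTransition.nonneg _

theorem smoothStep_le_one (t : ℝ) : smoothStep t ≤ 1 := Real.smoothTransition.le_one _

theorem smoothStep_of_le {t : ℝ} (h : t ≤ 1) : smoothStep t = 0 :=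
  Real.smoothTransition.zero_of_nonpos (by linarith)

theorem smoothStep_of_ge {t : ℝ} (h : 2 ≤ t) : smoothStep t = 1 :=
  Real.smoothTransition.one_of_one_le (by linarith)

theorem contDiff_smoothStep : ContDiff ℝ 1 smoothStep :=
  (Real.smoothTransition.contDiff (n := 1)).comp (contDiff_id.sub contDiff_const)

theorem exists_lipschitzWith_smoothStep : ∃ C : ℝ≥0, LipschitzWith C smoothStep := by
  have hc : Continuous (deriv smoothStep) := contDiff_smoothStep.continuous_deriv le_rfl
  obtain ⟨C, hC⟩ := (isCompact_Icc (a := (1 : ℝ)) (b := 2)).exists_bound_of_continuousOn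
    hc.continuousOn
  refine ⟨C.toNNReal, lipschitzWith_of_nnnorm_deriv_le
    (contDiff_smoothStep.differentiable one_ne_zero) fun t => ?_⟩
  rw [← NNReal.coe_le_coe, coe_nnnorm]
  refine le_trans ?_ (Real.le_coe_toNNReal C)
  have hC0 : 0 ≤ C := (norm_nonneg _).trans (hC 1 (by norm_num))
  by_cases h1 : t < 1
  · have : smoothStep =ᶠ[𝓝 t] fun _ => 0 := by
      filter_upwards [Iio_mem_nhds h1] with s hs
      exact smoothStep_of_le (le_of_lt hs)
    rw [this.deriv_eq]; simpa using hC0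
  by_cases h2 : 2 < t
  · have : smoothStep =ᶠ[𝓝 t] fun _ => 1 := by
      filter_upwards [Ioi_mem_nhds h2] with s hs
      exact smoothStep_of_ge (le_of_lt hs)
    rw [this.deriv_eq]; simpa using hC0
  exact hC t ⟨not_lt.1 h1, not_lt.1 h2⟩

end Step

section NormStep

variable {E : Type*} [NormedAddCommGroup E] [NormedSpace ℝ E] {p : Seminorm ℝ E}

theorem IsEquivalentNorm.exists_lipschitzWith (h : IsEquivalentNorm p) :
    ∃ C : ℝ≥0, LipschitzWith C p := by
  obtain ⟨c, C, -, hC, h⟩ := h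
  refine ⟨C.toNNReal, LipschitzWith.of_dist_le_mul fun x y => ?_⟩
  rw [Real.coe_toNNReal _ hC.le, Real.dist_eq, dist_eq_norm]
  refine le_trans ?_ (h (x - y)).2
  exact abs_sub_map_le_sub p x y

theorem IsEquivalentNorm.continuous (h : IsEquivalentNorm p) : Continuous p :=
  h.exists_lipschitzWith.choose_spec.continuous

theorem eventuallyEq_normStep_zero (h : IsEquivalentNorm p) (T : E →L[ℝ] E) (a : E) {r : ℝ}
    (hr : 0 < r) {x : E} (hx : p (T x - a) < r) :
    (fun y => smoothStep (p (T y - a) / r)) =ᶠ[𝓝 x] fun _ => 0 := by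
  have hp := h.continuous
  have hc : Continuous fun y => p (T y - a) := by fun_prop
  filter_upwards [hc.continuousAt.eventually (Iio_mem_nhds hx)] with y hy
  exact smoothStep_of_le ((div_le_one hr).2 (le_of_lt hy))

theorem ne_zero_of_le_seminorm {r : ℝ} (hr : 0 < r) {x : E} (hx : ¬ p x < r) : x ≠ 0 := by
  rintro rfl
  simp [hr] at hx

/-- The norm is not smooth at the origin, but the step is identically zero near every point where
the argument of `p` vanishes. The same remark gives finite determination below. -/
theorem contDiff_normStep (h : IsEquivalentNorm p) (h1 : IsC1Norm p) (T : E →L[ℝ] E) (a : E)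
    {r : ℝ} (hr : 0 < r) : ContDiff ℝ 1 fun y => smoothStep (p (T y - a) / r) := by
  rw [contDiff_iff_contDiffAt]
  intro x
  by_cases hx : p (T x - a) < r
  · exact contDiffAt_const.congr_of_eventuallyEq (eventuallyEq_normStep_zero h T a hr hx)
  have hp : ContDiffAt ℝ 1 p (T x - a) :=
    (h1 _ (ne_zero_of_le_seminorm hr hx)).contDiffAt
      (isOpen_compl_singleton.mem_nhds (ne_zero_of_le_seminorm hr hx))
  have hT : ContDiffAt ℝ 1 (fun y => T y - a) x := by fun_prop
  exact contDiff_smoothStep.contDiffAt.comp x ((hp.comp x hT).div_const r)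

theorem finitelyDeterminedAt_normStep (h : IsEquivalentNorm p)
    (h2 : LocallyDependsOnFinitelyManyCoordinates p) (T : E →L[ℝ] E) (a : E)
    {r : ℝ} (hr : 0 < r) (x : E) :
    FinitelyDeterminedAt univ (fun y => smoothStep (p (T y - a) / r)) x := by
  by_cases hx : p (T x - a) < r
  · exact (FinitelyDeterminedAt.const 0).congr (eventuallyEq_normStep_zero h T a hr hx)
  exact ((h2.finitelyDeterminedAt (ne_zero_of_le_seminorm hr hx)).comp_affine T a).map
    fun t => smoothStep (t / r)

/-- The derivative of `smoothStep (p (T y - a) / r)` is at most `C ‖T‖ / r`, with `C` depending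
on `p` only. -/
theorem exists_norm_fderiv_normStep_le (h : IsEquivalentNorm p) :
    ∃ C : ℝ, 0 ≤ C ∧ ∀ (T : E →L[ℝ] E) (a : E) (r : ℝ), 0 < r → ∀ x : E,
      ‖fderiv ℝ (fun y => smoothStep (p (T y - a) / r)) x‖ ≤ C * ‖T‖ / r := by
  obtain ⟨C₁, hC₁⟩ := exists_lipschitzWith_smoothStep
  obtain ⟨C₂, hC₂⟩ := h.exists_lipschitzWith
  refine ⟨C₁ * C₂, by positivity, fun T a r hr x => ?_⟩
  have hl : LipschitzWith (C₁ * C₂ * ‖T‖₊ / r.toNNReal)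
      fun y => smoothStep (p (T y - a) / r) := by
    refine LipschitzWith.of_dist_le_mul fun y z => ?_
    refine (hC₁.dist_le_mul _ _).trans ?_
    have e1 : dist (p (T y - a) / r) (p (T z - a) / r)
        = dist (p (T y - a)) (p (T z - a)) / r := by
      rw [Real.dist_eq, Real.dist_eq, ← sub_div, abs_div, abs_of_pos hr]
    have e2 : dist (T y - a) (T z - a) ≤ ‖T‖ * dist y z := by
      rw [dist_sub_right]; exact T.lipschitz.dist_le_mul y z
    have e3 := (hC₂.dist_le_mul (T y - a) (T z - a)).trans
      (mul_le_mul_of_nonneg_left e2 C₂.2)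
    rw [e1]
    push_cast
    rw [Real.coe_toNNReal _ hr.le]
    calc (C₁ : ℝ) * (dist (p (T y - a)) (p (T z - a)) / r)
        ≤ C₁ * ((C₂ * (‖T‖ * dist y z)) / r) := by gcongr
      _ = _ := by ring
  have := norm_fderiv_le_of_lipschitz ℝ hl (x₀ := x)
  push_cast at this
  rwa [Real.coe_toNNReal _ hr.le] at this

theorem fderiv_normStep_eq_zero (h : IsEquivalentNorm p) (T : E →L[ℝ] E) (a : E) {r : ℝ}
    (hr : 0 < r) {x : E} (hx : 2 * r < p (T x - a)) :
    fderiv ℝ (fun y => smoothStep (p (T y - a) / r)) x = 0 := by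
  have hp := h.continuous
  have hc : Continuous fun y => p (T y - a) := by fun_prop
  have : (fun y => smoothStep (p (T y - a) / r)) =ᶠ[𝓝 x] fun _ => 1 := by
    filter_upwards [hc.continuousAt.eventually (Ioi_mem_nhds hx)] with y hy
    exact smoothStep_of_ge ((le_div_iff₀ hr).2 (le_of_lt hy))
  rw [this.fderiv_eq]; simp

end NormStep

/-! ### Multipliers and tails of an unconditional basis -/

section BasisMultipliers

variable {E : Type*} [NormedAddCommGroup E] [NormedSpace ℝ E]

namespace UnconditionalSchauderBasis

/-- Tested against a functional, the claim concerns sums of real numbers. Unconditionality bounds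
the sums over all finite index sets, and splitting by sign bounds the sum of absolute values by
twice as much. -/
theorem exists_norm_multiplier_le [CompleteSpace E] {β : Type*}
    (b : UnconditionalSchauderBasis β ℝ E) :
    ∃ K : ℝ, 0 ≤ K ∧ ∀ (A : Finset β) (a : β → ℝ) (M : ℝ) (x : E), 0 ≤ M →
      (∀ i ∈ A, |a i| ≤ M) → ‖∑ i ∈ A, a i • b.coord i x • b i‖ ≤ K * M * ‖x‖ := by
  classical
  obtain ⟨C, hC⟩ := b.exists_norm_proj_le
  have hC0 : 0 ≤ C := (norm_nonneg _).trans (hC ∅)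
  refine ⟨2 * C, by positivity, fun A a M x hM ha => ?_⟩
  refine NormedSpace.norm_le_dual_bound ℝ _ (by positivity) fun f => ?_
  set u : β → ℝ := fun i => f (b.coord i x • b i) with hu
  have hsum : ∀ B : Finset β, |∑ i ∈ B, u i| ≤ ‖f‖ * (C * ‖x‖) := by
    intro B
    have : ∑ i ∈ B, u i = f (b.proj B x) := by
      rw [GeneralSchauderBasis.proj_apply, map_sum]
    rw [this]
    exact (f.le_opNorm _).trans
      (mul_le_mul_of_nonneg_left ((b.proj B).le_of_opNorm_le (hC B) x) (norm_nonneg f))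
  have habs : ∑ i ∈ A, |u i| ≤ 2 * (‖f‖ * (C * ‖x‖)) := by
    rw [← Finset.sum_filter_add_sum_filter_not A fun i => 0 ≤ u i]
    have e1 : ∑ i ∈ A with 0 ≤ u i, |u i| = ∑ i ∈ A with 0 ≤ u i, u i :=
      Finset.sum_congr rfl fun i hi => abs_of_nonneg (Finset.mem_filter.1 hi).2
    have e2 : ∑ i ∈ A with ¬ 0 ≤ u i, |u i| = -∑ i ∈ A with ¬ 0 ≤ u i, u i := by
      rw [← Finset.sum_neg_distrib]
      exact Finset.sum_congr rfl fun i hi =>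
        abs_of_neg (not_le.1 (Finset.mem_filter.1 hi).2)
    rw [e1, e2]
    have h1 := (le_abs_self _).trans (hsum {i ∈ A | 0 ≤ u i})
    have h2 := (neg_le_abs _).trans (hsum {i ∈ A | ¬ 0 ≤ u i})
    linarith
  calc ‖f (∑ i ∈ A, a i • b.coord i x • b i)‖ = |∑ i ∈ A, a i * u i| := by
        rw [map_sum, Real.norm_eq_abs]
        congr 1
        exact Finset.sum_congr rfl fun i _ => by rw [map_smul, smul_eq_mul]
    _ ≤ ∑ i ∈ A, |a i * u i| := Finset.abs_sum_le_sum_abs _ _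
    _ ≤ ∑ i ∈ A, M * |u i| := Finset.sum_le_sum fun i hi => by
        rw [abs_mul]; exact mul_le_mul_of_nonneg_right (ha i hi) (abs_nonneg _)
    _ = M * ∑ i ∈ A, |u i| := by rw [Finset.mul_sum]
    _ ≤ M * (2 * (‖f‖ * (C * ‖x‖))) := mul_le_mul_of_nonneg_left habs hM
    _ = 2 * C * M * ‖x‖ * ‖f‖ := by ring

variable (b : UnconditionalSchauderBasis ℕ ℝ E)

/-- The projection `x ↦ ∑_{i ≥ n} xᵢ eᵢ` onto the tail of the basis. -/
noncomputable def tail (n : ℕ) : E →L[ℝ] E :=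
  ContinuousLinearMap.id ℝ E - b.proj (Finset.range n)

theorem tail_apply (n : ℕ) (x : E) : b.tail n x = x - b.proj (Finset.range n) x := rfl

theorem coord_tail {n i : ℕ} (h : n ≤ i) (x : E) : b.coord i (b.tail n x) = b.coord i x := by
  rw [tail_apply, map_sub, GeneralSchauderBasis.proj_apply, map_sum,
    Finset.sum_eq_zero, sub_zero]
  intro j hj
  have hji : j < n := Finset.mem_range.1 hj
  have : i ≠ j := by omega
  have h0 : b.coord i (b j) = 0 := (b.ortho i j).trans (by simp [this])
  rw [map_smul, h0, smul_zero]

theorem tendsto_proj_range (x : E) :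
    Tendsto (fun n => b.proj (Finset.range n) x) atTop (𝓝 x) := by
  have h : HasSum (fun i => b.coord i x • b i) x := b.expansion x
  simpa [GeneralSchauderBasis.proj_apply] using h.tendsto_sum_nat

theorem tendsto_tail (x : E) : Tendsto (fun n => b.tail n x) atTop (𝓝 0) := by
  simpa [tail_apply] using (b.tendsto_proj_range x).const_sub x

theorem exists_norm_tail_le [CompleteSpace E] : ∃ C : ℝ, 0 ≤ C ∧ ∀ n, ‖b.tail n‖ ≤ C := by
  obtain ⟨C, hC⟩ := b.exists_norm_proj_le
  have hC0 : 0 ≤ C := (norm_nonneg _).trans (hC ∅)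
  refine ⟨1 + C, by positivity, fun n => (norm_sub_le _ _).trans ?_⟩
  exact add_le_add ContinuousLinearMap.norm_id_le (hC _)

theorem secondCountableTopology (b : UnconditionalSchauderBasis ℕ ℝ E) :
    SecondCountableTopology E := by
  have hs : TopologicalSpace.IsSeparable
      (closure (Submodule.span ℝ (range b.basis) : Set E)) :=
    ((countable_range b.basis).isSeparable.span (R := ℝ)).closure
  have hu : closure (Submodule.span ℝ (range b.basis) : Set E) = univ := by
    refine eq_univ_of_forall fun x => mem_closure_of_tendsto (b.tendsto_proj_range x) ?_
    refine Eventually.of_forall fun n => ?_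
    rw [GeneralSchauderBasis.proj_apply]
    exact Submodule.sum_mem _ fun i _ =>
      Submodule.smul_mem _ _ (Submodule.subset_span (mem_range_self i))
  rw [hu] at hs
  have := TopologicalSpace.isSeparable_univ_iff.1 hs
  exact UniformSpace.secondCountable_of_separable E

/-- If `n` is the least index with `a n ≠ 0`, the sum sees only the tail of `x` from `n` on, and
that tail is small by assumption. Hence the bound involves `s` in place of the norm of `x`. -/
theorem norm_sum_multiplier_le {K c : ℝ} {p : Seminorm ℝ E} (hK : 0 ≤ K) (hc : 0 < c)
    (hcp : ∀ x, c * ‖x‖ ≤ p x)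
    (hmul : ∀ (A : Finset ℕ) (a : ℕ → ℝ) (M : ℝ) (x : E), 0 ≤ M →
      (∀ i ∈ A, |a i| ≤ M) → ‖∑ i ∈ A, a i • b.coord i x • b i‖ ≤ K * M * ‖x‖)
    (A : Finset ℕ) (a : ℕ → ℝ) {M s : ℝ} (x : E) (hM : 0 ≤ M) (hs : 0 ≤ s)
    (ha : ∀ i ∈ A, |a i| ≤ M) (hsupp : ∀ i ∈ A, a i ≠ 0 → p (b.tail i x) ≤ s) :
    ‖∑ i ∈ A, a i • b.coord i x • b i‖ ≤ K * M * (s / c) := by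
  classical
  have e : ∑ i ∈ A, a i • b.coord i x • b i
      = ∑ i ∈ A with a i ≠ 0, a i • b.coord i x • b i := by
    rw [Finset.sum_filter_of_ne]
    intro i _ h h0
    simp [h0] at h
  rw [e]
  rcases Finset.eq_empty_or_nonempty {i ∈ A | a i ≠ 0} with h0 | h0
  · rw [h0]; simp only [Finset.sum_empty, norm_zero]; positivity
  set n := Finset.min' _ h0 with hn
  obtain ⟨hnA, hna⟩ := Finset.mem_filter.1 (Finset.min'_mem _ h0)
  have e2 : ∑ i ∈ A with a i ≠ 0, a i • b.coord i x • b i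
      = ∑ i ∈ A with a i ≠ 0, a i • b.coord i (b.tail n x) • b i :=
    Finset.sum_congr rfl fun i hi => by rw [b.coord_tail (Finset.min'_le _ i hi)]
  rw [e2]
  refine (hmul _ a M _ hM fun i hi => ha i (Finset.mem_filter.1 hi).1).trans ?_
  have : ‖b.tail n x‖ ≤ s / c := by
    rw [le_div_iff₀ hc, mul_comm]
    exact (hcp _).trans (hsupp n hnA hna)
  gcongr

end UnconditionalSchauderBasis

end BasisMultipliers

/-! ### Finitely determined maps near the identity -/

section TailCutoff

variable {E : Type*} [NormedAddCommGroup E] [NormedSpace ℝ E] {p : Seminorm ℝ E}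

namespace UnconditionalSchauderBasis

variable (b : UnconditionalSchauderBasis ℕ ℝ E)

/-- The tail projections are uniformly bounded, so their pointwise convergence to zero is locally
uniform. This makes the series defining `tailCutoff` locally a finite sum. -/
theorem exists_eventually_tail_lt [CompleteSpace E] (h : IsEquivalentNorm p) {r : ℝ}
    (hr : 0 < r) (x : E) : ∃ N, ∀ᶠ y in 𝓝 x, ∀ n, N ≤ n → p (b.tail n y) < r := by
  obtain ⟨C, hC, hCt⟩ := b.exists_norm_tail_le
  obtain ⟨c₁, c₂, -, hc₂, hp⟩ := h
  have h1 : ∀ᶠ n in atTop, ‖b.tail n x‖ < r / (2 * c₂) := by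
    have := (b.tendsto_tail x).norm
    rw [norm_zero] at this
    exact this.eventually (Iio_mem_nhds (by positivity))
  obtain ⟨N, hN⟩ := eventually_atTop.1 h1
  refine ⟨N, ?_⟩
  have h2 : ∀ᶠ y in 𝓝 x, C * ‖y - x‖ < r / (2 * c₂) := by
    have hcont : Continuous fun y => C * ‖y - x‖ := by fun_prop
    have := hcont.tendsto x
    rw [sub_self, norm_zero, mul_zero] at this
    exact this.eventually (Iio_mem_nhds (by positivity))
  filter_upwards [h2] with y hy n hn
  have e : b.tail n y = b.tail n x + b.tail n (y - x) := by rw [map_sub]; abel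
  have h3 : ‖b.tail n y‖ < r / c₂ := by
    rw [e]
    refine (norm_add_le _ _).trans_lt ?_
    have := ((b.tail n).le_of_opNorm_le (hCt n) (y - x)).trans_lt hy
    have e2 : r / c₂ = r / (2 * c₂) + r / (2 * c₂) := by field_simp; ring
    rw [e2]
    exact add_lt_add (hN n hn) this
  calc p (b.tail n y) ≤ c₂ * ‖b.tail n y‖ := (hp _).2
    _ < c₂ * (r / c₂) := mul_lt_mul_of_pos_left h3 hc₂
    _ = r := by field_simp

/-- The map `x ↦ ∑ χᵢ(x) xᵢ eᵢ`, where `χᵢ(x)` vanishes as soon as the tail of `x` from `i` on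
is shorter than `r`. -/
noncomputable def tailCutoff (p : Seminorm ℝ E) (r : ℝ) (x : E) : E :=
  ∑' i, smoothStep (p (b.tail i x) / r) • b.coord i x • b i

theorem exists_eventually_tailCutoff_eq [CompleteSpace E] (h : IsEquivalentNorm p) {r : ℝ}
    (hr : 0 < r) (x : E) : ∃ N, ∀ᶠ y in 𝓝 x, (∀ n, N ≤ n → p (b.tail n y) < r) ∧
      b.tailCutoff p r y
        = ∑ i ∈ Finset.range N, smoothStep (p (b.tail i y) / r) • b.coord i y • b i := by
  obtain ⟨N, hN⟩ := b.exists_eventually_tail_lt h hr x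
  refine ⟨N, hN.mono fun y hy => ⟨hy, tsum_eq_sum fun i hi => ?_⟩⟩
  have : N ≤ i := by simpa using hi
  rw [smoothStep_of_le ((div_le_one hr).2 (hy i this).le), zero_smul]

theorem contDiff_tailCutoff [CompleteSpace E] (h : IsEquivalentNorm p) (h1 : IsC1Norm p) {r : ℝ}
    (hr : 0 < r) : ContDiff ℝ 1 (b.tailCutoff p r) := by
  rw [contDiff_iff_contDiffAt]
  intro x
  obtain ⟨N, hN⟩ := b.exists_eventually_tailCutoff_eq h hr x
  refine ContDiffAt.congr_of_eventuallyEq ?_ (hN.mono fun y hy => hy.2)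
  refine ContDiffAt.sum fun i _ => ?_
  have hχ := contDiff_normStep h h1 (b.tail i) 0 hr
  simp only [sub_zero] at hχ
  exact hχ.contDiffAt.smul (by fun_prop)

theorem finitelyDeterminedAt_tailCutoff [CompleteSpace E] (h : IsEquivalentNorm p)
    (h2 : LocallyDependsOnFinitelyManyCoordinates p) {r : ℝ} (hr : 0 < r) (x : E) :
    FinitelyDeterminedAt univ (b.tailCutoff p r) x := by
  obtain ⟨N, hN⟩ := b.exists_eventually_tailCutoff_eq h hr x
  refine FinitelyDeterminedAt.congr ?_ (hN.mono fun y hy => hy.2)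
  refine FinitelyDeterminedAt.sum _ fun i _ => ?_
  have hχ := finitelyDeterminedAt_normStep h h2 (b.tail i) 0 hr x
  simp only [sub_zero] at hχ
  exact hχ.map₂ (FinitelyDeterminedAt.functional (b.coord i)) fun s t => s • t • b i

/-- There are `C¹` maps locally depending on finitely many functionals which are arbitrarily
close to the identity and have derivatives bounded by a common constant. -/
theorem exists_contDiff_finitelyDetermined_near_id [CompleteSpace E]
    (b : UnconditionalSchauderBasis ℕ ℝ E)
    (h : IsEquivalentNorm p) (h1 : IsC1Norm p)
    (h2 : LocallyDependsOnFinitelyManyCoordinates p) :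
    ∃ C : ℝ, 0 ≤ C ∧ ∀ s : ℝ, 0 < s → ∃ Φ : E → E, ContDiff ℝ 1 Φ ∧
      (∀ x, FinitelyDeterminedAt univ Φ x) ∧ (∀ x, ‖Φ x - x‖ ≤ s) ∧
      ∀ x, ‖fderiv ℝ Φ x‖ ≤ C := by
  obtain ⟨K, hK, hmul⟩ := b.exists_norm_multiplier_le
  obtain ⟨D, hD, hstep⟩ := exists_norm_fderiv_normStep_le h
  obtain ⟨C, hC, htail⟩ := b.exists_norm_tail_le
  have h' := h
  obtain ⟨c, _, hc, _, hp⟩ := h'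
  have hcp : ∀ x, c * ‖x‖ ≤ p x := fun x => (hp x).1
  have key : ∀ r : ℝ, 0 < r → (∀ x, ‖b.tailCutoff p r x - x‖ ≤ K * 1 * (2 * r / c)) ∧
      ∀ x, ‖fderiv ℝ (b.tailCutoff p r) x‖ ≤ K + K * (D * C) * (2 / c) := by
    intro r hr
    refine ⟨fun x => ?_, fun x => ?_⟩
    · obtain ⟨N, hN⟩ := b.exists_eventually_tailCutoff_eq h hr x
      obtain ⟨hN, heq⟩ := hN.self_of_nhds
      rw [norm_sub_rev]
      -- Replace `x` by its partial sums. The coefficient `1 - χᵢ(x)` of the difference vanishes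
      -- unless the tail from `i` on has size at most `2 * r`.
      refine le_of_tendsto ((b.tendsto_proj_range x).sub_const _).norm ?_
      filter_upwards [eventually_ge_atTop N] with m hm
      have e : b.proj (Finset.range m) x - b.tailCutoff p r x
          = ∑ i ∈ Finset.range m, (1 - smoothStep (p (b.tail i x) / r)) •
            b.coord i x • b i := by
        have : b.tailCutoff p r x = ∑ i ∈ Finset.range m,
            smoothStep (p (b.tail i x) / r) • b.coord i x • b i := by
          rw [heq]
          refine Finset.sum_subset (Finset.range_mono hm) fun i _ hi => ?_
          have : N ≤ i := by simpa using hi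
          rw [smoothStep_of_le ((div_le_one hr).2 (hN i this).le), zero_smul]
        rw [this, GeneralSchauderBasis.proj_apply, ← Finset.sum_sub_distrib]
        exact Finset.sum_congr rfl fun i _ => by rw [sub_smul, one_smul]
      rw [e]
      refine b.norm_sum_multiplier_le hK hc hcp hmul _ _ x zero_le_one (by positivity)
        (fun i _ => ?_) fun i _ hi => ?_
      · rw [abs_of_nonneg (sub_nonneg.2 (smoothStep_le_one _))]
        linarith [smoothStep_nonneg (p (b.tail i x) / r)]
      · by_contra hlt
        exact hi (by rw [smoothStep_of_ge ((le_div_iff₀ hr).2 (not_le.1 hlt).le), sub_self])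
    · obtain ⟨N, hN⟩ := b.exists_eventually_tailCutoff_eq h hr x
      have heq : b.tailCutoff p r =ᶠ[𝓝 x] fun y => ∑ i ∈ Finset.range N,
          smoothStep (p (b.tail i y) / r) • b.coord i y • b i := hN.mono fun y hy => hy.2
      set χ' : ℕ → StrongDual ℝ E :=
        fun i => fderiv ℝ (fun y => smoothStep (p (b.tail i y) / r)) x with hχ'
      have hd : HasFDerivAt (b.tailCutoff p r) (∑ i ∈ Finset.range N,
          (smoothStep (p (b.tail i x) / r) • (b.coord i).smulRight (b i)
            + (χ' i).smulRight (b.coord i x • b i))) x := by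
        refine HasFDerivAt.congr_of_eventuallyEq ?_ heq
        refine HasFDerivAt.fun_sum fun i _ => ?_
        have hχ := contDiff_normStep h h1 (b.tail i) 0 hr
        simp only [sub_zero] at hχ
        have e1 : HasFDerivAt (fun y => smoothStep (p (b.tail i y) / r)) (χ' i) x :=
          (hχ.differentiable one_ne_zero x).hasFDerivAt
        have e2 : HasFDerivAt (fun y => b.coord i y • b i) ((b.coord i).smulRight (b i)) x :=
          ((b.coord i).smulRight (b i)).hasFDerivAt
        exact e1.smul e2
      rw [hd.fderiv]
      refine ContinuousLinearMap.opNorm_le_bound _ (by positivity) fun v => ?_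
      have e : (∑ i ∈ Finset.range N,
          (smoothStep (p (b.tail i x) / r) • (b.coord i).smulRight (b i)
            + (χ' i).smulRight (b.coord i x • b i))) v
          = (∑ i ∈ Finset.range N, smoothStep (p (b.tail i x) / r) • b.coord i v • b i)
            + ∑ i ∈ Finset.range N, χ' i v • b.coord i x • b i := by
        rw [← Finset.sum_add_distrib, sum_apply]
        exact Finset.sum_congr rfl fun i _ => by simp
      rw [e]
      have b1 : ‖∑ i ∈ Finset.range N, smoothStep (p (b.tail i x) / r) • b.coord i v • b i‖
          ≤ K * 1 * ‖v‖ := by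
        refine hmul _ _ 1 v zero_le_one fun i _ => ?_
        rw [abs_of_nonneg (smoothStep_nonneg _)]
        exact smoothStep_le_one _
      -- The derivative of a step is of order `1 / r`, but it is nonzero only where the tail has
      -- size at most `2 * r`. The powers of `r` cancel, so the final bound does not depend on `r`.
      have b2 : ‖∑ i ∈ Finset.range N, χ' i v • b.coord i x • b i‖
          ≤ K * (D * C / r * ‖v‖) * (2 * r / c) := by
        refine b.norm_sum_multiplier_le hK hc hcp hmul _ _ x (by positivity) (by positivity)
          (fun i _ => ?_) fun i _ hi => ?_
        · have hi := hstep (b.tail i) 0 r hr x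
          simp only [sub_zero] at hi
          refine (χ' i).le_of_opNorm_le (hi.trans ?_) v
          have := htail i
          gcongr
        · by_contra hlt
          have h0 := fderiv_normStep_eq_zero h (b.tail i) 0 hr (x := x)
            (by simpa using not_le.1 hlt)
          simp only [sub_zero] at h0
          exact hi (by rw [hχ']; simp only [h0]; simp)
      refine (norm_add_le _ _).trans ((add_le_add b1 b2).trans (le_of_eq ?_))
      field_simp
  refine ⟨K + K * (D * C) * (2 / c), by positivity, fun s hs => ?_⟩
  set r : ℝ := s * c / (2 * (K + 1)) with hr
  have hr0 : 0 < r := by positivity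
  refine ⟨b.tailCutoff p r, b.contDiff_tailCutoff h h1 hr0,
    b.finitelyDeterminedAt_tailCutoff h h2 hr0, fun x => ((key r hr0).1 x).trans ?_,
    (key r hr0).2⟩
  have : K * 1 * (2 * r / c) = s * (K / (K + 1)) := by rw [hr]; field_simp
  rw [this]
  exact mul_le_of_le_one_right hs.le ((div_le_one (by positivity)).2 (by linarith))

end UnconditionalSchauderBasis

end TailCutoff

/-! ### Functionals independent of a countable family -/

section IndependentFunctionals

/-- A Banach space spanned by countably many vectors is finite-dimensional. -/
theorem finiteDimensional_of_span_countable_eq_top {X : Type*} [NormedAddCommGroup X]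
    [NormedSpace ℝ X] [CompleteSpace X] {s : Set X} (hs : s.Countable)
    (h : Submodule.span ℝ s = ⊤) : FiniteDimensional ℝ X := by
  classical
  have hc : Countable s := hs.to_subtype
  set W : Finset s → Submodule ℝ X := fun A => Submodule.span ℝ ((↑) '' (A : Set s)) with hW
  have hfin : ∀ A, FiniteDimensional ℝ (W A) := fun A =>
    FiniteDimensional.span_of_finite ℝ (A.finite_toSet.image _)
  have hU : ⋃ A, (W A : Set X) = univ := by
    refine eq_univ_of_forall fun x => ?_
    have hx : x ∈ Submodule.span ℝ s := by rw [h]; trivial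
    obtain ⟨T, hTs, hxT⟩ := Submodule.mem_span_finite_of_mem_span hx
    refine mem_iUnion.2 ⟨T.subtype (· ∈ s), ?_⟩
    refine Submodule.span_mono (fun y hy => ?_) hxT
    exact ⟨⟨y, hTs hy⟩, by simpa using hy, rfl⟩
  -- Baire: the spans of the finite subsets of `s` are countably many closed subspaces covering `X`.
  obtain ⟨A, hA⟩ := nonempty_interior_of_iUnion_of_closed
    (fun A => Submodule.closed_of_finiteDimensional (W A)) hU
  have htop := (W A).eq_top_of_nonempty_interior' hA
  have := hfin A
  rw [htop] at this
  exact Module.finite_def.2 ((Submodule.fg_top _).1 (Module.finite_def.1 this))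

/-- The quotient by the span is infinite-dimensional: otherwise `s` together with finitely many
lifts would be a countable spanning set. The `t i` lift independent vectors of the quotient. -/
theorem exists_linearIndependent_mod_span_countable {X : Type*} [NormedAddCommGroup X]
    [NormedSpace ℝ X] [CompleteSpace X] (hX : ¬ FiniteDimensional ℝ X) {s : Set X}
    (hs : s.Countable) (d : ℕ) : ∃ t : Fin d → X, ∀ a : Fin d → ℝ,
      ∑ i, a i • t i ∈ Submodule.span ℝ s → a = 0 := by
  set W := Submodule.span ℝ s with hW
  have hq : ¬ Module.Finite ℝ (X ⧸ W) := by
    intro hfin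
    obtain ⟨T, hT⟩ := Module.finite_def.1 hfin
    choose lift hlift using W.mkQ_surjective
    refine hX (finiteDimensional_of_span_countable_eq_top
      (hs.union (T.countable_toSet.image lift)) (eq_top_iff.2 fun x _ => ?_))
    have hx : W.mkQ x ∈ Submodule.map W.mkQ (Submodule.span ℝ (lift '' T)) := by
      rw [Submodule.map_span, image_image]
      simp only [hlift, image_id', hT, Submodule.mem_top]
    obtain ⟨y, hy, hxy⟩ := hx
    have hd : x - y ∈ W := by
      rw [← Submodule.ker_mkQ W, LinearMap.mem_ker, map_sub, hxy, sub_self]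
    have := Submodule.add_mem _ (Submodule.span_mono (subset_union_left) hd)
      (Submodule.span_mono (t := s ∪ lift '' T) subset_union_right hy)
    simpa using this
  have hr : (d : Cardinal) ≤ Module.rank ℝ (X ⧸ W) := by
    rw [← Module.rank_lt_aleph0_iff, not_lt] at hq
    exact (Cardinal.natCast_le_aleph0).trans hq
  obtain ⟨u, hu⟩ := exists_linearIndependent_of_le_rank hr
  choose lift hlift using W.mkQ_surjective
  refine ⟨fun i => lift (u i), fun a ha => ?_⟩
  rw [← Submodule.ker_mkQ W, LinearMap.mem_ker, map_sum] at ha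
  simp only [map_smul, hlift] at ha
  funext i
  exact Fintype.linearIndependent_iff.1 hu a ha i

variable {E : Type*} [NormedAddCommGroup E] [NormedSpace ℝ E]

theorem UnconditionalSchauderBasis.not_finiteDimensional_dual
    (b : UnconditionalSchauderBasis ℕ ℝ E) : ¬ FiniteDimensional ℝ (StrongDual ℝ E) := by
  intro hfin
  have hli : LinearIndependent ℝ b.coord := by
    rw [linearIndependent_iff']
    intro s g hg i hi
    have h1 := DFunLike.congr_fun hg (b i)
    rw [sum_apply, Finset.sum_eq_single i] at h1
    · have h0 : b.coord i (b i) = 1 := (b.ortho i i).trans (by simp)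
      simpa [h0] using h1
    · intro j _ hj
      have h0 : b.coord j (b i) = 0 := (b.ortho j i).trans (by simp [hj])
      simp [h0]
    · exact fun h => absurd hi h
  exact not_finite_iff_infinite.2 (inferInstance : Infinite ℕ) hli.finite

/-- If `t` is linearly independent modulo the span of `s`, then `(t₁, …, t_d)` is onto already on
the common kernel of finitely many elements of `s`. -/
theorem exists_eq_of_linearIndependent_mod_span {d : ℕ} {s : Set (StrongDual ℝ E)}
    {t : Fin d → StrongDual ℝ E}
    (ht : ∀ a : Fin d → ℝ, ∑ i, a i • t i ∈ Submodule.span ℝ s → a = 0)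
    (A : Finset (StrongDual ℝ E)) (hA : ↑A ⊆ s) (w : Fin d → ℝ) :
    ∃ v : E, (∀ L ∈ A, L v = 0) ∧ ∀ i, t i v = w i := by
  classical
  set K : Submodule ℝ E := ⨅ L : A, LinearMap.ker (L.1 : E →ₗ[ℝ] ℝ) with hK
  set T : E →ₗ[ℝ] (Fin d → ℝ) := LinearMap.pi fun i => (t i : E →ₗ[ℝ] ℝ) with hT
  suffices h : Submodule.map T K = ⊤ by
    have hw : w ∈ Submodule.map T K := by rw [h]; trivial
    obtain ⟨v, hv, rfl⟩ := hw
    refine ⟨v, fun L hL => ?_, fun i => rfl⟩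
    exact LinearMap.mem_ker.1 ((Submodule.mem_iInf _).1 hv ⟨L, hL⟩)
  -- A nonzero `φ` killing the image of `K` gives a combination of the `t i` vanishing on the common
  -- kernel of `A`. It then lies in the span of `A`, so its coefficients, and with them `φ`, vanish.
  by_contra hne
  obtain ⟨φ, hφ, hle⟩ := Submodule.exists_le_ker_of_lt_top _ (lt_top_iff_ne_top.2 hne)
  set a : Fin d → ℝ := fun i => φ (Pi.single i 1) with ha
  have hφa : ∀ v : E, φ (T v) = (∑ i, a i • t i) v := by
    intro v
    rw [LinearMap.pi_apply_eq_sum_univ φ (T v), sum_apply]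
    refine Finset.sum_congr rfl fun i _ => ?_
    have e : (fun j => if i = j then (1 : ℝ) else 0) = Pi.single i 1 := by
      ext j
      simp [Pi.single_apply, eq_comm]
    rw [smul_apply, smul_eq_mul, smul_eq_mul, mul_comm, e]
    rfl
  have hmem : ((∑ i, a i • t i : StrongDual ℝ E) : E →ₗ[ℝ] ℝ) ∈
      Submodule.span ℝ (range fun L : A => (L.1 : E →ₗ[ℝ] ℝ)) := by
    refine mem_span_of_iInf_ker_le_ker fun v hv => ?_
    rw [LinearMap.mem_ker]
    have := LinearMap.mem_ker.1 (hle (Submodule.mem_map_of_mem (f := T) hv))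
    rwa [hφa] at this
  have hspan : ∑ i, a i • t i ∈ Submodule.span ℝ s := by
    refine Submodule.span_mono hA ?_
    obtain ⟨c, hc⟩ := (Submodule.mem_span_range_iff_exists_fun ℝ).1 hmem
    have : ∑ i, a i • t i = ∑ L : A, c L • L.1 := by
      ext v
      have := LinearMap.congr_fun hc v
      simpa [sum_apply] using this.symm
    rw [this]
    exact Submodule.sum_mem _ fun L _ => Submodule.smul_mem _ _ (Submodule.subset_span L.2)
  have h0 := ht a hspan
  refine hφ (LinearMap.pi_ext' fun i => LinearMap.ext_ring ?_)
  simpa [ha] using congr_fun h0 i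

end IndependentFunctionals

/-! ### Finitely determined partitions of unity -/

section PartitionOfUnity

variable {E : Type*} [NormedAddCommGroup E] [NormedSpace ℝ E] {p : Seminorm ℝ E}

/-- `ψ` is a locally finite `C¹` partition of unity on `U`, with `ψ n` supported in `V n`, with
derivative bounded by `M n`, and locally depending on finitely many functionals. -/
structure IsFinitelyDeterminedPartition (U : Set E) (V : ℕ → Set E) (M : ℕ → ℝ)
    (ψ : ℕ → E → ℝ) : Prop where
  contDiff : ∀ n, ContDiff ℝ 1 (ψ n)
  finitelyDetermined : ∀ n x, FinitelyDeterminedAt univ (ψ n) x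
  nonneg : ∀ n x, 0 ≤ ψ n x
  norm_fderiv_le : ∀ n x, ‖fderiv ℝ (ψ n) x‖ ≤ M n
  eventuallyEq_zero : ∀ n x, x ∉ V n → ψ n =ᶠ[𝓝 x] fun _ => 0
  exists_eventually : ∀ x ∈ U, ∃ N, ∀ᶠ y in 𝓝 x,
    (∀ n, N ≤ n → ψ n y = 0) ∧ ∑ n ∈ Finset.range N, ψ n y = 1

theorem norm_fderiv_prod_le {χ : ℕ → E → ℝ} (hχ : ∀ n, ContDiff ℝ 1 (χ n))
    (h1 : ∀ n x, |χ n x| ≤ 1) {D : ℕ → ℝ} (hD : ∀ n x, ‖fderiv ℝ (χ n) x‖ ≤ D n) (n : ℕ) :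
    ∀ x, ‖fderiv ℝ (fun y => ∏ j ∈ Finset.range n, χ j y) x‖ ≤ ∑ j ∈ Finset.range n, D j := by
  intro x
  induction n with
  | zero => simp
  | succ n ih =>
    have hq : ContDiff ℝ 1 fun y => ∏ j ∈ Finset.range n, χ j y :=
      contDiff_prod fun j _ => hχ j
    have hq1 : |∏ j ∈ Finset.range n, χ j x| ≤ 1 := by
      rw [Finset.abs_prod]
      exact Finset.prod_le_one (fun _ _ => abs_nonneg _) fun j _ => h1 j x
    simp only [Finset.prod_range_succ, Finset.sum_range_succ]
    rw [fderiv_fun_mul (hq.differentiable one_ne_zero x) ((hχ n).differentiable one_ne_zero x),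
      add_comm (∑ j ∈ Finset.range n, D j)]
    refine (norm_add_le _ _).trans (add_le_add ?_ ?_)
    · rw [norm_smul, Real.norm_eq_abs]
      exact (mul_le_of_le_one_left (norm_nonneg _) hq1).trans (hD n x)
    · rw [norm_smul, Real.norm_eq_abs]
      exact (mul_le_of_le_one_left (norm_nonneg _) (h1 n x)).trans ih

/-- Each `χ n` is zero near `a n` and one outside `V (a n)`. The differences of consecutive partial
products `q n` telescope to one as soon as some factor vanishes, and `q n - q (n + 1) = q n * (1 - χ
n)` is nonnegative and supported where `χ n` is not one. -/
theorem exists_isFinitelyDeterminedPartition [SecondCountableTopology E]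
    (h : IsEquivalentNorm p) (h1 : IsC1Norm p)
    (h2 : LocallyDependsOnFinitelyManyCoordinates p) {U : Set E} (hU : U.Nonempty)
    {V : E → Set E} (hV : ∀ x ∈ U, V x ∈ 𝓝 x) :
    ∃ (a : ℕ → E) (M : ℕ → ℝ) (ψ : ℕ → E → ℝ), (∀ n, a n ∈ U) ∧
      IsFinitelyDeterminedPartition U (fun n => V (a n)) M ψ := by
  obtain ⟨D, hD, hstep⟩ := exists_norm_fderiv_normStep_le h
  have hp := h.continuous
  have hr : ∀ x ∈ U, ∃ r : ℝ, 0 < r ∧ ∀ y, p (y - x) ≤ 2 * r → y ∈ V x := by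
    intro x hx
    obtain ⟨c, C, hc, -, hcC⟩ := h
    obtain ⟨ρ, hρ, hball⟩ := Metric.mem_nhds_iff.1 (hV x hx)
    refine ⟨c * ρ / 4, by positivity, fun y hy => hball ?_⟩
    rw [Metric.mem_ball, dist_eq_norm]
    have h3 := (hcC (y - x)).1.trans hy
    have : c * ‖y - x‖ < c * ρ := by nlinarith [mul_pos hc hρ]
    exact lt_of_mul_lt_mul_left this hc.le
  choose! r hr0 hrV using hr
  obtain ⟨s, hsU, hs, hcov⟩ := TopologicalSpace.countable_cover_nhdsWithin
    (s := U) (f := fun x => {y | p (y - x) < r x}) fun x hx => by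
      refine mem_nhdsWithin_of_mem_nhds (IsOpen.mem_nhds ?_ ?_)
      · exact isOpen_lt (by fun_prop) continuous_const
      · simpa using hr0 x hx
  have hsne : s.Nonempty := by
    obtain ⟨x, hx⟩ := hU
    obtain ⟨y, hy, -⟩ := mem_iUnion₂.1 (hcov hx)
    exact ⟨y, hy⟩
  obtain ⟨a, rfl⟩ := hs.exists_eq_range hsne
  have haU : ∀ n, a n ∈ U := fun n => hsU (mem_range_self n)
  set χ : ℕ → E → ℝ := fun n y =>
    smoothStep (p (ContinuousLinearMap.id ℝ E y - a n) / r (a n)) with hχdef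
  have hχ : ∀ n, ContDiff ℝ 1 (χ n) := fun n =>
    contDiff_normStep h h1 _ _ (hr0 _ (haU n))
  have hχ0 : ∀ n y, 0 ≤ χ n y := fun n y => smoothStep_nonneg _
  have hχ1 : ∀ n y, χ n y ≤ 1 := fun n y => smoothStep_le_one _
  have hχabs : ∀ n y, |χ n y| ≤ 1 := fun n y => by
    rw [abs_of_nonneg (hχ0 n y)]; exact hχ1 n y
  have hχfd : ∀ n y, FinitelyDeterminedAt univ (χ n) y := fun n y =>
    finitelyDeterminedAt_normStep h h2 _ _ (hr0 _ (haU n)) y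
  set q : ℕ → E → ℝ := fun n y => ∏ j ∈ Finset.range n, χ j y with hqdef
  have hq : ∀ n, ContDiff ℝ 1 (q n) := fun n => contDiff_prod fun j _ => hχ j
  have hqfd : ∀ n y, FinitelyDeterminedAt univ (q n) y := by
    intro n y
    induction n with
    | zero => exact (FinitelyDeterminedAt.const 1).congr (Eventually.of_forall fun z => by
        simp [hqdef])
    | succ n ih =>
      refine (ih.map₂ (hχfd n y) (· * ·)).congr (Eventually.of_forall fun z => ?_)
      simp only [hqdef, Finset.prod_range_succ]
  have hqsucc : ∀ n y, q (n + 1) y = q n y * χ n y := fun n y => Finset.prod_range_succ _ _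
  set B : ℕ → ℝ := fun n => ∑ j ∈ Finset.range n,
    D * ‖ContinuousLinearMap.id ℝ E‖ / r (a j)
  have hqD : ∀ n x, ‖fderiv ℝ (q n) x‖ ≤ B n := norm_fderiv_prod_le hχ hχabs
    fun n x => hstep _ _ _ (hr0 _ (haU n)) x
  refine ⟨a, fun n => B n + B (n + 1), fun n y => q n y - q (n + 1) y, haU, ⟨fun n => (hq n).sub (hq (n + 1)),
    fun n x => (hqfd n x).map₂ (hqfd (n + 1) x) (· - ·), fun n x => ?_, fun n x => ?_,
    fun n x hx => ?_, fun x hx => ?_⟩⟩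
  · have : q n x - q (n + 1) x = q n x * (1 - χ n x) := by rw [hqsucc]; ring
    rw [this]
    exact mul_nonneg (Finset.prod_nonneg fun j _ => hχ0 j x) (sub_nonneg.2 (hχ1 n x))
  · rw [fderiv_fun_sub ((hq n).differentiable one_ne_zero x)
      ((hq (n + 1)).differentiable one_ne_zero x)]
    exact (norm_sub_le _ _).trans (add_le_add (hqD n x) (hqD (n + 1) x))
  · have hlt : 2 * r (a n) < p (x - a n) := by
      by_contra hle
      exact hx (hrV _ (haU n) x (not_lt.1 hle))
    have hc : Continuous fun y => p (y - a n) := by fun_prop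
    filter_upwards [hc.continuousAt.eventually (Ioi_mem_nhds hlt)] with y hy
    have : χ n y = 1 :=
      smoothStep_of_ge ((le_div_iff₀ (hr0 _ (haU n))).2 (le_of_lt hy))
    rw [hqsucc, this, mul_one, sub_self]
  · obtain ⟨-, ⟨N, rfl⟩, hN⟩ := mem_iUnion₂.1 (hcov hx)
    -- `q n` contains the factor `χ N` only from `n = N + 1` on.
    refine ⟨N + 1, ?_⟩
    have hz : χ N =ᶠ[𝓝 x] fun _ => 0 :=
      eventuallyEq_normStep_zero h _ _ (hr0 _ (haU N)) hN
    filter_upwards [hz] with y hy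
    have hq0 : ∀ n, N + 1 ≤ n → q n y = 0 := fun n hn =>
      Finset.prod_eq_zero (Finset.mem_range.2 hn) hy
    refine ⟨fun n hn => by rw [hq0 n hn, hq0 (n + 1) (by omega), sub_self], ?_⟩
    rw [Finset.sum_range_sub', hq0 (N + 1) le_rfl, sub_zero]
    simp [hqdef]

theorem sum_half_pow_succ (N : ℕ) :
    ∑ n ∈ Finset.range N, (1 / 2 : ℝ) ^ (n + 1) = 1 - (1 / 2) ^ N := by
  induction N with
  | zero => simp
  | succ k ih => rw [Finset.sum_range_succ, ih]; ring

namespace IsFinitelyDeterminedPartition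

variable {F : Type*} [NormedAddCommGroup F] [NormedSpace ℝ F] {U : Set E} {V : ℕ → Set E}
  {M : ℕ → ℝ} {ψ : ℕ → E → ℝ}

theorem bound_nonneg (hψ : IsFinitelyDeterminedPartition U V M ψ) (n : ℕ) : 0 ≤ M n :=
  (norm_nonneg _).trans (hψ.norm_fderiv_le n 0)

theorem eq_zero (hψ : IsFinitelyDeterminedPartition U V M ψ) {n : ℕ} {x : E} (hx : x ∉ V n) :
    ψ n x = 0 :=
  (hψ.eventuallyEq_zero n x hx).self_of_nhds

theorem tsum_smul_eq_zero (hψ : IsFinitelyDeterminedPartition U V M ψ) (hV : ∀ n, V n ⊆ U)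
    (u : ℕ → E → F) {x : E} (hx : x ∉ U) : ∑' n, ψ n x • u n x = 0 := by
  simp [hψ.eq_zero fun h => hx (hV _ h)]

theorem eventually_tsum_eq (hψ : IsFinitelyDeterminedPartition U V M ψ) {x : E} (hx : x ∈ U) :
    ∃ N, ∀ᶠ y in 𝓝 x, ∑ n ∈ Finset.range N, ψ n y = 1 ∧ ∀ u : ℕ → E → F,
      ∑' n, ψ n y • u n y = ∑ n ∈ Finset.range N, ψ n y • u n y := by
  obtain ⟨N, hN⟩ := hψ.exists_eventually x hx
  refine ⟨N, hN.mono fun y hy => ⟨hy.2, fun u => tsum_eq_sum fun n hn => ?_⟩⟩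
  have : N ≤ n := by simpa using hn
  rw [hy.1 n this, zero_smul]

theorem contDiffAt_tsum_smul (hψ : IsFinitelyDeterminedPartition U V M ψ) {u : ℕ → E → F}
    (hu : ∀ n, ContDiff ℝ 1 (u n)) {x : E} (hx : x ∈ U) :
    ContDiffAt ℝ 1 (fun y => ∑' n, ψ n y • u n y) x := by
  obtain ⟨N, hN⟩ := hψ.eventually_tsum_eq (F := F) hx
  refine ContDiffAt.congr_of_eventuallyEq ?_ (hN.mono fun y hy => hy.2 u)
  exact ContDiffAt.sum fun n _ => ((hψ.contDiff n).smul (hu n)).contDiffAt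

/-- In the product rule, the terms with `D(u n)` form a convex combination. The terms with `D(ψ n)`
have no uniform bound, so the `u n` must be small enough to absorb `M n` with a summable remainder.
-/
theorem norm_tsum_smul_le (hψ : IsFinitelyDeterminedPartition U V M ψ) {u : ℕ → E → F}
    (hu : ∀ n, ContDiff ℝ 1 (u n)) {δ : ℝ} {x : E} (hx : x ∈ U)
    (h0 : ∀ n, x ∈ V n → (1 + M n) * ‖u n x‖ ≤ δ / 2 * (1 / 2) ^ (n + 1))
    (h1 : ∀ n, x ∈ V n → ‖fderiv ℝ (u n) x‖ ≤ δ / 2) :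
    ‖∑' n, ψ n x • u n x‖ ≤ δ ∧ ‖fderiv ℝ (fun y => ∑' n, ψ n y • u n y) x‖ ≤ δ := by
  obtain ⟨N, hN⟩ := hψ.eventually_tsum_eq (F := F) hx
  obtain ⟨hsum, heq⟩ := hN.self_of_nhds
  have hδ : 0 ≤ δ := by
    have : ∃ n, x ∈ V n := by
      by_contra hcon
      push Not at hcon
      simp [hψ.eq_zero (hcon _)] at hsum
    obtain ⟨n, hn⟩ := this
    linarith [(norm_nonneg _).trans (h1 n hn)]
  have hgeom : ∑ n ∈ Finset.range N, δ / 2 * (1 / 2 : ℝ) ^ (n + 1) ≤ δ / 2 := by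
    rw [← Finset.mul_sum]
    refine mul_le_of_le_one_right (by linarith) ?_
    have := sum_half_pow_succ N
    rw [this]
    linarith [pow_nonneg (by norm_num : (0 : ℝ) ≤ 1 / 2) N]
  have hψ1 : ∀ n ∈ Finset.range N, ψ n x ≤ 1 := fun n hn => by
    rw [← hsum]
    exact Finset.single_le_sum (f := fun n => ψ n x) (fun i _ => hψ.nonneg i x) hn
  have hM := hψ.bound_nonneg
  refine ⟨?_, ?_⟩
  · rw [heq]
    refine (norm_sum_le_of_le _ fun n hn => ?_).trans (hgeom.trans (by linarith))
    by_cases hxn : x ∈ V n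
    · rw [norm_smul, Real.norm_eq_abs, abs_of_nonneg (hψ.nonneg n x)]
      refine le_trans ?_ (h0 n hxn)
      have := hψ1 n hn
      have := hM n
      gcongr
      linarith
    · rw [hψ.eq_zero hxn, zero_smul, norm_zero]; positivity
  · have he : (fun y => ∑' n, ψ n y • u n y) =ᶠ[𝓝 x]
        fun y => ∑ n ∈ Finset.range N, ψ n y • u n y := hN.mono fun y hy => hy.2 u
    have hd : HasFDerivAt (fun y => ∑ n ∈ Finset.range N, ψ n y • u n y)
        (∑ n ∈ Finset.range N, (ψ n x • fderiv ℝ (u n) x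
          + (fderiv ℝ (ψ n) x).smulRight (u n x))) x :=
      HasFDerivAt.fun_sum fun n _ =>
        ((hψ.contDiff n).differentiable one_ne_zero x).hasFDerivAt.smul
          ((hu n).differentiable one_ne_zero x).hasFDerivAt
    rw [he.fderiv_eq, hd.fderiv, Finset.sum_add_distrib]
    have b1 : ‖∑ n ∈ Finset.range N, ψ n x • fderiv ℝ (u n) x‖ ≤ δ / 2 := by
      refine (norm_sum_le_of_le (f := fun n => ψ n x • fderiv ℝ (u n) x)
        (n := fun n => ψ n x * (δ / 2)) _ fun n _ => ?_).trans ?_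
      · rw [norm_smul, Real.norm_eq_abs, abs_of_nonneg (hψ.nonneg n x)]
        by_cases hxn : x ∈ V n
        · exact mul_le_mul_of_nonneg_left (h1 n hxn) (hψ.nonneg n x)
        · simp [hψ.eq_zero hxn]
      · rw [← Finset.sum_mul, hsum, one_mul]
    have b2 : ‖∑ n ∈ Finset.range N, (fderiv ℝ (ψ n) x).smulRight (u n x)‖ ≤ δ / 2 := by
      refine (norm_sum_le_of_le _ fun n _ => ?_).trans hgeom
      rw [ContinuousLinearMap.norm_smulRight_apply]
      by_cases hxn : x ∈ V n
      · refine le_trans ?_ (h0 n hxn)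
        have := hψ.norm_fderiv_le n x
        gcongr
        linarith
      · rw [(hψ.eventuallyEq_zero n x hxn).fderiv_eq]
        simp only [fderiv_fun_const, Pi.zero_apply, norm_zero, zero_mul]
        positivity
    exact (norm_add_le _ _).trans (by linarith)

end IsFinitelyDeterminedPartition

end PartitionOfUnity

/-! ### Extending a perturbation by zero outside an open set -/

section ExtensionByZero

variable {E F : Type*} [NormedAddCommGroup E] [NormedSpace ℝ E] [NormedAddCommGroup F]
  [NormedSpace ℝ F]

/-- A positive continuous function on `U`, below a given one, that vanishes to second order
outside `U`. -/
theorem exists_continuous_le_dist_sq {E : Type*} [NormedAddCommGroup E] {ε : E → ℝ} (hε : Continuous ε) (hε0 : ∀ x, 0 < ε x)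
    {U : Set E} (hU : IsOpen U) : ∃ δ : E → ℝ, Continuous δ ∧ (∀ x ∈ U, 0 < δ x) ∧
      (∀ x, δ x ≤ ε x) ∧ ∀ x ∉ U, ∀ y, δ y ≤ ‖y - x‖ ∧ δ y ≤ ‖y - x‖ ^ 2 := by
  rcases Uᶜ.eq_empty_or_nonempty with hemp | hne
  · obtain rfl := compl_empty_iff.1 hemp
    exact ⟨ε, hε, fun x _ => hε0 x, fun x => le_rfl, fun x hx => absurd (mem_univ x) hx⟩
  have hc := Metric.continuous_infDist_pt Uᶜ
  refine ⟨fun x => min (ε x) (min (Metric.infDist x Uᶜ) (Metric.infDist x Uᶜ ^ 2)),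
    by fun_prop, fun x hx => ?_, fun x => min_le_left _ _, fun x hx y => ?_⟩
  · have : 0 < Metric.infDist x Uᶜ :=
      (hU.isClosed_compl.notMem_iff_infDist_pos hne).1 (by simpa using hx)
    have := hε0 x
    positivity
  · have hd : Metric.infDist y Uᶜ ≤ ‖y - x‖ := by
      rw [← dist_eq_norm]; exact Metric.infDist_le_dist_of_mem hx
    exact ⟨((min_le_right _ _).trans (min_le_left _ _)).trans hd,
      ((min_le_right _ _).trans (min_le_right _ _)).trans
        (pow_le_pow_left₀ Metric.infDist_nonneg hd 2)⟩

/-- The quadratic bound on `G` forces the derivative to be zero at points outside `U`; the linear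
bound on the derivative makes it continuous there. -/
theorem contDiff_of_le_dist_sq {U : Set E} {G : E → F} {δ : E → ℝ}
    (hδ : ∀ x ∉ U, ∀ y, δ y ≤ ‖y - x‖ ∧ δ y ≤ ‖y - x‖ ^ 2)
    (hG0 : ∀ x ∉ U, G x = 0) (hG : ∀ x ∈ U, ContDiffAt ℝ 1 G x)
    (hGδ : ∀ x ∈ U, ‖G x‖ ≤ δ x) (hGδ' : ∀ x ∈ U, ‖fderiv ℝ G x‖ ≤ δ x) :
    ContDiff ℝ 1 G ∧ ∀ x ∉ U, fderiv ℝ G x = 0 := by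
  have hd : ∀ x ∉ U, HasFDerivAt G (0 : E →L[ℝ] F) x := by
    intro x hx
    have hb : ∀ y, ‖G y - G x‖ ≤ ‖y - x‖ ^ 2 := by
      intro y
      rw [hG0 x hx, sub_zero]
      by_cases hy : y ∈ U
      · exact (hGδ y hy).trans (hδ x hx y).2
      · rw [hG0 y hy, norm_zero]; positivity
    rw [hasFDerivAt_iff_isLittleO]
    simp only [zero_apply, sub_zero]
    refine (Asymptotics.IsBigO.of_bound 1 (Eventually.of_forall fun y => ?_)).trans_isLittleO
      (Asymptotics.isLittleO_pow_sub_sub x one_lt_two)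
    simpa using hb y
  have hf0 : ∀ x ∉ U, fderiv ℝ G x = 0 := fun x hx => (hd x hx).fderiv
  refine ⟨contDiff_one_iff_fderiv.2 ⟨fun x => ?_, continuous_iff_continuousAt.2 fun x => ?_⟩,
    hf0⟩
  · by_cases hx : x ∈ U
    · exact (hG x hx).differentiableAt one_ne_zero
    · exact (hd x hx).differentiableAt
  · by_cases hx : x ∈ U
    · exact ((hG x hx).fderiv_right (m := 0) (by norm_num)).continuousAt
    · rw [ContinuousAt, hf0 x hx, tendsto_zero_iff_norm_tendsto_zero]
      have hcont : Tendsto (fun y => ‖y - x‖) (𝓝 x) (𝓝 0) := by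
        have : Continuous fun y => ‖y - x‖ := by fun_prop
        simpa using this.tendsto x
      refine squeeze_zero (fun _ => norm_nonneg _) (fun y => ?_) hcont
      by_cases hy : y ∈ U
      · exact (hGδ' y hy).trans (hδ x hx y).1
      · rw [hf0 y hy, norm_zero]; positivity

end ExtensionByZero

/-! ### Perturbing away the critical points in an open set -/

section Perturbation

variable {E : Type*} [NormedAddCommGroup E] [NormedSpace ℝ E] {d : ℕ}

/-- If maps near the identity with locally finitely determined values and derivatives bounded by
`C` exist, then `f` has locally finitely determined `C¹` approximations on each ball on which its
derivative is almost constant. -/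
theorem exists_finitelyDetermined_approx {C : ℝ}
    (hΦ : ∀ s : ℝ, 0 < s → ∃ Φ : E → E, ContDiff ℝ 1 Φ ∧
      (∀ x, FinitelyDeterminedAt univ Φ x) ∧ (∀ x, ‖Φ x - x‖ ≤ s) ∧
      ∀ x, ‖fderiv ℝ Φ x‖ ≤ C)
    {f : E → EuclideanSpace ℝ (Fin d)} (hf : ContDiff ℝ 1 f) {x : E} {R η : ℝ} (hR : 0 < R)
    (hη : ∀ y ∈ Metric.ball x (2 * R), ‖fderiv ℝ f y - fderiv ℝ f x‖ ≤ η)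
    {κ : ℝ} (hκ : 0 < κ) :
    ∃ g : E → EuclideanSpace ℝ (Fin d), ContDiff ℝ 1 g ∧
      (∀ y, FinitelyDeterminedAt univ g y) ∧ ∀ y ∈ Metric.ball x R, ‖g y - f y‖ ≤ κ ∧
        ‖fderiv ℝ g y - fderiv ℝ f y‖ ≤ η * (C + 1) := by
  have hη0 : 0 ≤ η := (norm_nonneg _).trans (hη x (Metric.mem_ball_self (by positivity)))
  -- `R / 2` keeps `Φ y` in the doubled ball; `κ / (η + 1)` makes the mean value bound `η * ‖Φ y -
  -- y‖` at most `κ`, also when `η = 0`.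
  obtain ⟨Φ, hΦ1, hΦfd, hΦs, hΦC⟩ := hΦ (min (R / 2) (κ / (η + 1))) (by positivity)
  set D := fderiv ℝ f x with hD
  have hdf := hf.differentiable one_ne_zero
  have hdΦ := hΦ1.differentiable one_ne_zero
  -- In the derivative error, `DΦ` is composed only with the small map `Df(Φ y) - D`, so boundedness
  -- of `DΦ` suffices.
  refine ⟨fun y => f (Φ y) + (D y - D (Φ y)), ?_, fun y => ?_, fun y hy => ?_⟩
  · exact (hf.comp hΦ1).add (D.contDiff.sub (D.contDiff.comp hΦ1))
  · exact (hΦfd y).map₂ (FinitelyDeterminedAt.linear_euclidean D) fun z w => f z + (w - D z)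
  have hy' : y ∈ Metric.ball x (2 * R) := Metric.ball_subset_ball (by linarith) hy
  have hΦy : Φ y ∈ Metric.ball x (2 * R) := by
    rw [Metric.mem_ball] at hy ⊢
    have h1 := (hΦs y).trans (min_le_left _ _)
    rw [← dist_eq_norm] at h1
    linarith [dist_triangle (Φ y) y x]
  constructor
  · have h1 := (convex_ball x (2 * R)).norm_image_sub_le_of_norm_fderiv_le' (𝕜 := ℝ)
      (fun z _ => hdf z) hη hy' hΦy
    have e : f (Φ y) + (D y - D (Φ y)) - f y = f (Φ y) - f y - D (Φ y - y) := by
      rw [map_sub]; abel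
    rw [e]
    refine h1.trans ?_
    calc η * ‖Φ y - y‖ ≤ η * (κ / (η + 1)) :=
          mul_le_mul_of_nonneg_left ((hΦs y).trans (min_le_right _ _)) hη0
      _ = κ * (η / (η + 1)) := by ring
      _ ≤ κ := mul_le_of_le_one_right hκ.le ((div_le_one (by positivity)).2 (by linarith))
  · have h1 : HasFDerivAt (fun y => f (Φ y) + (D y - D (Φ y)))
        ((fderiv ℝ f (Φ y)).comp (fderiv ℝ Φ y) + (D - D.comp (fderiv ℝ Φ y))) y :=
      ((hdf (Φ y)).hasFDerivAt.comp y (hdΦ y).hasFDerivAt).add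
        (D.hasFDerivAt.sub (D.hasFDerivAt.comp y (hdΦ y).hasFDerivAt))
    have e : (fderiv ℝ f (Φ y)).comp (fderiv ℝ Φ y) + (D - D.comp (fderiv ℝ Φ y))
        - fderiv ℝ f y = (fderiv ℝ f (Φ y) - D).comp (fderiv ℝ Φ y) - (fderiv ℝ f y - D) := by
      rw [ContinuousLinearMap.sub_comp]; abel
    rw [h1.fderiv, e, mul_add, mul_one]
    refine (norm_sub_le _ _).trans (add_le_add ?_ (hη y hy'))
    refine (ContinuousLinearMap.opNorm_comp_le _ _).trans ?_
    have := hη _ hΦy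
    have := hΦC y
    gcongr

/-- If `φ = h + ψ T` near `x`, where `h` and `ψ` are finitely determined at `x` by functionals in
`s`, `ψ x ≠ 0`, and `T` has components linearly independent modulo the span of `s`, then `x` is
not a critical point of `φ`. -/
theorem surjective_fderiv_of_finitelyDetermined {s : Set (StrongDual ℝ E)}
    {t : Fin d → StrongDual ℝ E}
    (ht : ∀ a : Fin d → ℝ, ∑ i, a i • t i ∈ Submodule.span ℝ s → a = 0)
    {T : E →L[ℝ] EuclideanSpace ℝ (Fin d)} (hT : ∀ v i, T v i = t i v)
    {φ h : E → EuclideanSpace ℝ (Fin d)} {ψ : E → ℝ} {x : E}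
    (hφ : DifferentiableAt ℝ φ x) (hh : FinitelyDeterminedAt s h x)
    (hψ : FinitelyDeterminedAt s ψ x) (hψ0 : ψ x ≠ 0)
    (heq : φ =ᶠ[𝓝 x] fun y => h y + ψ y • T y) : Function.Surjective (fderiv ℝ φ x) := by
  intro w
  obtain ⟨A, hA, hline⟩ := (hh.map₂ hψ Prod.mk).eventually_line
  obtain ⟨v, hv, hvt⟩ := exists_eq_of_linearIndependent_mod_span ht A hA fun i => (ψ x)⁻¹ * w i
  refine ⟨v, ?_⟩
  have hTv : ψ x • T v = w := by
    ext i
    simp [hT, hvt, hψ0]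
  have hcont : Tendsto (fun r : ℝ => x + r • v) (𝓝 0) (𝓝 x) := by
    have : Continuous fun r : ℝ => x + r • v := by fun_prop
    simpa using this.tendsto 0
  have h1 : HasDerivAt (fun r : ℝ => φ (x + r • v)) (fderiv ℝ φ x v) 0 :=
    hφ.hasFDerivAt.hasLineDerivAt v
  have h2 : (fun r : ℝ => φ (x + r • v)) =ᶠ[𝓝 0] fun r => h x + ψ x • T x + r • w := by
    filter_upwards [hcont.eventually heq, hline v hv] with r hr hr'
    obtain ⟨e1, e2⟩ := Prod.mk.inj hr'
    rw [hr, e1, e2, map_add, map_smul, smul_add, smul_comm (ψ x) r, hTv, add_assoc]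
  have h3 : HasDerivAt (fun r : ℝ => h x + ψ x • T x + r • w) w 0 := by
    simpa using ((hasDerivAt_id (0 : ℝ)).smul_const w).const_add (h x + ψ x • T x)
  exact h1.unique (h3.congr_of_eventuallyEq h2)

/-- Around each point of `U` there is a ball contained in `U` on which `δ` and `Df` are almost
constant. -/
theorem exists_radius_almost_constant {F : Type*} [NormedAddCommGroup F] [NormedSpace ℝ F]
    {f : E → F} (hf : ContDiff ℝ 1 f) {U : Set E}
    (hU : IsOpen U) {δ : E → ℝ} (hδ : Continuous δ) (hδ0 : ∀ x ∈ U, 0 < δ x) {C : ℝ}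
    (hC : 0 < C) : ∀ x ∈ U, ∃ R : ℝ, 0 < R ∧ Metric.ball x R ⊆ U ∧
      (∀ y ∈ Metric.ball x R, δ x / 2 ≤ δ y) ∧
      ∀ y ∈ Metric.ball x (2 * R), ‖fderiv ℝ f y - fderiv ℝ f x‖ ≤ δ x / (16 * C) := by
  intro x hx
  have hx0 := hδ0 x hx
  have h1 : ∀ᶠ y in 𝓝 x, δ x / 2 < δ y := hδ.continuousAt.eventually (Ioi_mem_nhds (by linarith))
  have h2 : ∀ᶠ y in 𝓝 x, ‖fderiv ℝ f y - fderiv ℝ f x‖ < δ x / (16 * C) := by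
    have hc : Continuous fun y => ‖fderiv ℝ f y - fderiv ℝ f x‖ :=
      ((hf.continuous_fderiv one_ne_zero).sub continuous_const).norm
    refine hc.continuousAt.eventually (Iio_mem_nhds ?_)
    simp only [sub_self, norm_zero]; positivity
  obtain ⟨ρ, hρ, hball⟩ := Metric.eventually_nhds_iff_ball.1
    ((h1.and h2).and (hU.mem_nhds hx))
  have hsub : ∀ y ∈ Metric.ball x (ρ / 2), y ∈ Metric.ball x ρ :=
    fun y hy => Metric.ball_subset_ball (by linarith) hy
  refine ⟨ρ / 2, by positivity, fun y hy => (hball y (hsub y hy)).2,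
    fun y hy => (hball y (hsub y hy)).1.1.le, fun y hy => (hball y ?_).1.2.le⟩
  rwa [mul_div_cancel₀ ρ two_ne_zero] at hy

/-- The map `f` can be perturbed inside `U` so that it has no critical points in `U`. -/
theorem exists_perturbation_without_critical_points [CompleteSpace E]
    (b : UnconditionalSchauderBasis ℕ ℝ E) {p : Seminorm ℝ E} (h : IsEquivalentNorm p)
    (h1 : IsC1Norm p) (h2 : LocallyDependsOnFinitelyManyCoordinates p)
    {f : E → EuclideanSpace ℝ (Fin d)} (hf : ContDiff ℝ 1 f) {U : Set E} (hU : IsOpen U)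
    (hne : U.Nonempty) {δ : E → ℝ} (hδ : Continuous δ) (hδ0 : ∀ x ∈ U, 0 < δ x) :
    ∃ G : E → EuclideanSpace ℝ (Fin d), (∀ x ∉ U, G x = 0) ∧ ∀ x ∈ U,
      ContDiffAt ℝ 1 G x ∧ ‖G x‖ ≤ δ x ∧ ‖fderiv ℝ G x‖ ≤ δ x ∧
      Function.Surjective (fderiv ℝ (fun y => f y + G y) x) := by
  have := b.secondCountableTopology
  obtain ⟨C, hC, hΦ⟩ := b.exists_contDiff_finitelyDetermined_near_id h h1 h2
  have hC1 : 0 < C + 1 := by positivity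
  choose! R hR0 hRU hRδ hRf using exists_radius_almost_constant hf hU hδ hδ0 hC1
  obtain ⟨a, M, ψ, haU, hψ⟩ := exists_isFinitelyDeterminedPartition h h1 h2 hne
    fun x hx => Metric.ball_mem_nhds x (hR0 x hx)
  have hM := hψ.bound_nonneg
  have hδa : ∀ n, 0 < δ (a n) := fun n => hδ0 _ (haU n)
  -- The size of `u n` will be at most `2 * κ n`, and `δ (a n) ≤ 2 * δ x` on the `n`-th ball; the
  -- factor `1 / 8` then meets the requirement of `norm_tsum_smul_le`.
  set κ : ℕ → ℝ := fun n => δ (a n) / 8 * (1 / 2) ^ (n + 1) / (1 + M n) with hκdef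
  have hκ0 : ∀ n, 0 < κ n := fun n => by
    have := hδa n
    have := hM n
    positivity
  have hκM : ∀ n, (1 + M n) * κ n = δ (a n) / 8 * (1 / 2) ^ (n + 1) := fun n => by
    have := hM n
    rw [hκdef]; field_simp
  have hκδ : ∀ n, κ n ≤ δ (a n) / 8 := fun n => by
    have e1 : δ (a n) / 8 * (1 / 2) ^ (n + 1) ≤ δ (a n) / 8 :=
      mul_le_of_le_one_right (by linarith [hδa n]) (pow_le_one₀ (by norm_num) (by norm_num))
    rw [← hκM n] at e1
    exact (le_mul_of_one_le_left (hκ0 n).le (by linarith [hM n])).trans e1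
  choose g hg hgfd hgapp using fun n =>
    exists_finitelyDetermined_approx hΦ hf (hR0 _ (haU n)) (hRf _ (haU n)) (hκ0 n)
  choose S hS hψS using fun n => FinitelyDeterminedAt.exists_countable (hψ.finitelyDetermined n)
  choose S' hS' hgS using fun n => FinitelyDeterminedAt.exists_countable (hgfd n)
  -- Only the functionals of the `ψ n` and `g n` are collected: `f` itself cancels from the final
  -- sum.
  set W : Set (StrongDual ℝ E) := ⋃ n, (S n ∪ S' n) with hW
  have hWc : W.Countable := countable_iUnion fun n => (hS n).union (hS' n)
  obtain ⟨t, ht⟩ := exists_linearIndependent_mod_span_countable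
    b.not_finiteDimensional_dual hWc d
  set T : E →L[ℝ] EuclideanSpace ℝ (Fin d) :=
    ((EuclideanSpace.equiv (Fin d) ℝ).symm : (Fin d → ℝ) →L[ℝ] EuclideanSpace ℝ (Fin d)).comp
      (ContinuousLinearMap.pi t) with hTdef
  have hT : ∀ v i, T v i = t i v := fun v i => rfl
  -- `B n` bounds both `T` on the `n`-th ball and, thanks to the summand one, the operator norm of
  -- `T`.
  set B : ℕ → ℝ := fun n => ‖T‖ * (‖a n‖ + R (a n) + 1) with hB
  have hB0 : ∀ n, 0 ≤ B n := fun n => by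
    have := hR0 _ (haU n)
    positivity
  set c : ℕ → ℝ := fun n => κ n / (B n + 1) with hc
  have hc0 : ∀ n, 0 < c n := fun n => div_pos (hκ0 n) (by linarith [hB0 n])
  have hcB : ∀ n, c n * B n ≤ κ n := fun n => by
    have := hB0 n
    have e : c n * B n = κ n * (B n / (B n + 1)) := by rw [hc]; field_simp
    rw [e]
    exact mul_le_of_le_one_right (hκ0 n).le ((div_le_one (by positivity)).2 (by linarith))
  set u : ℕ → E → EuclideanSpace ℝ (Fin d) := fun n y => (g n y - f y) + c n • T y with hu
  have hucd : ∀ n, ContDiff ℝ 1 (u n) := fun n =>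
    ((hg n).sub hf).add (T.contDiff.const_smul (c n))
  have hu0 : ∀ n, ∀ y ∈ Metric.ball (a n) (R (a n)), ‖u n y‖ ≤ 2 * κ n := by
    intro n y hy
    have e1 : ‖y‖ ≤ ‖a n‖ + R (a n) + 1 := by
      have := norm_le_norm_add_norm_sub' y (a n)
      rw [← dist_eq_norm] at this
      linarith [Metric.mem_ball.1 hy]
    have e2 : ‖c n • T y‖ ≤ κ n := by
      rw [norm_smul, Real.norm_eq_abs, abs_of_pos (hc0 n)]
      exact (mul_le_mul_of_nonneg_left ((T.le_opNorm y).trans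
        (mul_le_mul_of_nonneg_left e1 (norm_nonneg _))) (hc0 n).le).trans (hcB n)
    exact (norm_add_le _ _).trans (by linarith [(hgapp n y hy).1])
  have hu1 : ∀ n, ∀ y ∈ Metric.ball (a n) (R (a n)),
      ‖fderiv ℝ (u n) y‖ ≤ δ (a n) / 4 := by
    intro n y hy
    have hd : HasFDerivAt (u n) ((fderiv ℝ (g n) y - fderiv ℝ f y) + c n • T) y :=
      ((((hg n).differentiable one_ne_zero) y).hasFDerivAt.sub
        ((hf.differentiable one_ne_zero) y).hasFDerivAt).add (T.hasFDerivAt.const_smul (c n))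
    rw [hd.fderiv]
    have e1 : ‖c n • T‖ ≤ κ n := by
      rw [norm_smul, Real.norm_eq_abs, abs_of_pos (hc0 n)]
      refine le_trans (mul_le_mul_of_nonneg_left ?_ (hc0 n).le) (hcB n)
      exact le_mul_of_one_le_right (norm_nonneg _)
        (by linarith [norm_nonneg (a n), hR0 _ (haU n)])
    have e2 := (hgapp n y hy).2
    have e3 : δ (a n) / (16 * (C + 1)) * (C + 1) = δ (a n) / 16 := by field_simp
    rw [e3] at e2
    exact (norm_add_le _ _).trans (by linarith [hκδ n, hδa n])
  refine ⟨fun y => ∑' n, ψ n y • u n y, fun x hx =>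
    hψ.tsum_smul_eq_zero (fun n => hRU _ (haU n)) u hx, fun x hx => ?_⟩
  have hG := hψ.contDiffAt_tsum_smul hucd hx
  obtain ⟨hb0, hb1⟩ := hψ.norm_tsum_smul_le hucd (δ := δ x) hx
    (fun n hn => by
      have e1 := mul_le_mul_of_nonneg_left (hu0 n x hn) (by linarith [hM n] : 0 ≤ 1 + M n)
      refine e1.trans ?_
      have e2 : (1 + M n) * (2 * κ n) = δ (a n) / 4 * (1 / 2) ^ (n + 1) := by
        linear_combination 2 * hκM n
      rw [e2]
      have := hRδ _ (haU n) x hn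
      gcongr ?_ * _
      linarith)
    (fun n hn => (hu1 n x hn).trans (by linarith [hRδ _ (haU n) x hn]))
  refine ⟨hG, hb0, hb1, ?_⟩
  obtain ⟨N, hN⟩ := hψ.eventually_tsum_eq (F := EuclideanSpace ℝ (Fin d)) hx
  have hWψ : ∀ n, FinitelyDeterminedAt W (ψ n) x := fun n =>
    (hψS n x).mono (subset_union_left.trans (subset_iUnion (fun n => S n ∪ S' n) n))
  have hWg : ∀ n, FinitelyDeterminedAt W (g n) x := fun n =>
    (hgS n x).mono (subset_union_right.trans (subset_iUnion (fun n => S n ∪ S' n) n))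
  have hsum := hN.self_of_nhds.1
  refine surjective_fderiv_of_finitelyDetermined ht hT
    (h := fun y => ∑ n ∈ Finset.range N, ψ n y • g n y)
    (ψ := fun y => ∑ n ∈ Finset.range N, ψ n y * c n)
    (((hf.differentiable one_ne_zero) x).add (hG.differentiableAt one_ne_zero))
    (FinitelyDeterminedAt.sum _ fun n _ => (hWψ n).map₂ (hWg n) (· • ·))
    (FinitelyDeterminedAt.sum _ fun n _ => (hWψ n).map (· * c n)) (ne_of_gt ?_) ?_
  · obtain ⟨n, hn, hn0⟩ := Finset.exists_ne_zero_of_sum_ne_zero (hsum.trans_ne one_ne_zero)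
    exact Finset.sum_pos' (fun i _ => mul_nonneg (hψ.nonneg i x) (hc0 i).le)
      ⟨n, hn, mul_pos (lt_of_le_of_ne (hψ.nonneg n x) (Ne.symm hn0)) (hc0 n)⟩
  · filter_upwards [hN] with y hy
    rw [hy.2 u, Finset.sum_smul, ← Finset.sum_add_distrib]
    -- Since the `ψ n` sum to one, adding `f` cancels the `- f` in each `u n`, leaving `∑ ψ n • g n`
    -- plus the positive scalar function `∑ ψ n * c n` times `T`.
    have e : f y = ∑ n ∈ Finset.range N, ψ n y • f y := by
      rw [← Finset.sum_smul, hy.1, one_smul]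
    nth_rewrite 1 [e]
    rw [← Finset.sum_add_distrib]
    refine Finset.sum_congr rfl fun n _ => ?_
    simp only [hu]
    module

end Perturbation

theorem theorem1p2 {E : Type*} [NormedAddCommGroup E] [NormedSpace ℝ E] [CompleteSpace E]
    (hinf : ¬ FiniteDimensional ℝ E)
    (hbasis : Nonempty (UnconditionalSchauderBasis ℕ ℝ E))
    (hnorm : ∃ p : Seminorm ℝ E, IsEquivalentNorm p ∧ IsC1Norm p ∧
      LocallyDependsOnFinitelyManyCoordinates p)
    (d : ℕ) (f : E → EuclideanSpace ℝ (Fin d)) (hf : ContDiff ℝ 1 f)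
    (ε : E → ℝ) (hε : Continuous ε) (hεpos : ∀ x, 0 < ε x)
    (U : Set E) (hU : IsOpen U) (hfU : criticalSet f ⊆ U) :
    ∃ φ : E → EuclideanSpace ℝ (Fin d), ContDiff ℝ 1 φ ∧
      (∀ x, ‖f x - φ x‖ ≤ ε x) ∧
      (∀ x, x ∉ U → f x = φ x) ∧
      (∀ x, ‖fderiv ℝ f x - fderiv ℝ φ x‖ ≤ ε x) ∧
      (∀ x, Function.Surjective (fderiv ℝ φ x)) := by
  obtain ⟨b⟩ := hbasis
  obtain ⟨p, h, h1, h2⟩ := hnorm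
  have hreg : ∀ x ∉ U, Function.Surjective (fderiv ℝ f x) := fun x hx => by
    by_contra hcrit
    exact hx (hfU hcrit)
  rcases U.eq_empty_or_nonempty with rfl | hne
  · exact ⟨f, hf, fun x => by simpa using (hεpos x).le, fun _ _ => rfl,
      fun x => by simpa using (hεpos x).le, fun x => hreg x (notMem_empty x)⟩
  obtain ⟨δ, hδ, hδ0, hδε, hδU⟩ := exists_continuous_le_dist_sq hε hεpos hU
  obtain ⟨G, hG0, hG⟩ := exists_perturbation_without_critical_points b h h1 h2 hf hU hne hδ hδ0
  obtain ⟨hGcd, hGf⟩ := contDiff_of_le_dist_sq hδU hG0 (fun x hx => (hG x hx).1)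
    (fun x hx => (hG x hx).2.1) fun x hx => (hG x hx).2.2.1
  have hfd : ∀ x, fderiv ℝ (fun y => f y + G y) x = fderiv ℝ f x + fderiv ℝ G x := fun x =>
    fderiv_fun_add (hf.differentiable one_ne_zero x) (hGcd.differentiable one_ne_zero x)
  refine ⟨fun y => f y + G y, hf.add hGcd, fun x => ?_, fun x hx => ?_, fun x => ?_, fun x => ?_⟩
  · rw [sub_add_cancel_left, norm_neg]
    by_cases hx : x ∈ U
    · exact (hG x hx).2.1.trans (hδε x)
    · rw [hG0 x hx, norm_zero]; exact (hεpos x).le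
  · simp [hG0 x hx]
  · rw [hfd, sub_add_cancel_left, norm_neg]
    by_cases hx : x ∈ U
    · exact (hG x hx).2.2.1.trans (hδε x)
    · rw [hGf x hx, norm_zero]; exact (hεpos x).le
  · by_cases hx : x ∈ U
    · exact (hG x hx).2.2.2
    -- Outside `U` the perturbation has zero derivative, and `f` has no critical points there.
    · rw [hfd, hGf x hx, add_zero]; exact hreg x hx
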